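/- **Conventions.** All C*-algebras are unital and nonzero. For a C*-algebra $\mathfrak A$, $\mathfrak{sa}(\mathfrak A)$ is its self-adjoint part and $\mathscr S(\mathfrak A)$ its state space. A seminorm $\mathsf L$ defined on a real subspace $\mathrm{dom}(\mathsf L)$ of $\mathfrak{sa}(\mathfrak A)$ is extended by $\infty$ outside $\mathrm{dom}(\mathsf L)$, and $\mathsf{mk}_{\mathsf L}(\varphi,\psi)=\sup\{|\varphi(a)-\psi(a)| : a\in\mathfrak{sa}(\mathfrak A),\ \mathsf L(a)\le 1\}$ for $\varphi,\psi\in\mathscr S(\mathfrak A)$. For $C\ge 1$ and $D\ge 0$, a *$(C,D)$-quasi-Leibniz quantum compact metric space* is a pair $(\mathfrak A,\mathsf L)$, where $\mathfrak A$ is a unital C*-algebra and $\mathsf L$ is a seminorm on a dense Jordan–Lie subalgebra $\mathrm{dom}(\mathsf L)$ of $\mathfrak{sa}(\mathfrak A)$, such that: $\{a\in\mathfrak{sa}(\mathfrak A):\mathsf L(a)=0\}=\mathbb R1_{\mathfrak A}$; both $\mathsf L\left(\frac{ab+ba}{2}\right)$ and $\mathsf L\left(\frac{ab-ba}{2i}\right)$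 are at most $C(\|a\|\,\mathsf L(b)+\|b\|\,\mathsf L(a))+D\,\mathsf L(a)\mathsf L(b)$ for all $a,b\in\mathrm{dom}(\mathsf L)$; $\mathsf{mk}_{\mathsf L}$ is a metric on $\mathscr S(\mathfrak A)$ that induces the weak* topology; and $\mathsf L$ is lower semicontinuous for the norm. A *bridge* $\gamma=(\mathfrak D,\pi_{\mathfrak A},\pi_{\mathfrak B},\omega)$ from $\mathfrak A$ to $\mathfrak B$ consists of a unital C*-algebra $\mathfrak D$, unital *-monomorphisms $\pi_{\mathfrak A}:\mathfrak A\to\mathfrak D$ and $\pi_{\mathfrak B}:\mathfrak B\to\mathfrak D$, and an element $\omega\in\mathfrak D$ for which $\mathscr S_1(\mathfrak D|\omega)=\{\varphi\in\mathscr S(\mathfrak D):\varphi(1-\omega^*\omega)=\varphi(1-\omega\omega^*)=0\}$ is nonempty. With respect to $\mathsf L_{\mathfrak A}$ and $\mathsf L_{\mathfrak B}$, its *height* is the larger of the $\mathsf{mk}_{\mathsf L_{\mathfrak A}}$-Hausdorff distance between $\mathscr S(\mathfrak A)$ and $\{\varphi\circ\pi_{\mathfrak A}:\varphi\in\mathscr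 S_1(\mathfrak D|\omega)\}$ and the analogous quantity for $\mathfrak B$. Its *reach* is the Hausdorff distance between $\{(a,0): a\in\mathfrak{sa}(\mathfrak A),\ \mathsf L_{\mathfrak A}(a)\le1\}$ and $\{(0,b): b\in\mathfrak{sa}(\mathfrak B),\ \mathsf L_{\mathfrak B}(b)\le1\}$ for the seminorm $(a,b)\mapsto\|\pi_{\mathfrak A}(a)\omega-\omega\pi_{\mathfrak B}(b)\|_{\mathfrak D}$ on $\mathfrak A\oplus\mathfrak B$. Its *length* is the larger of its height and its reach. The *quantum propinquity* $\mathsf\Lambda_{C,D}$ is the largest pseudo-distance on the class of $(C,D)$-quasi-Leibniz quantum compact metric spaces that is bounded above by the length of every bridge between its arguments; equivalently, it is the infimum of the sums of the lengths of the bridges over all finite chains of bridges that join the two spaces through such spaces. Write $\mathsf\Lambda=\mathsf\Lambda_{2,0}$. A *conditional expectation* of $\mathfrak A$ onto a C*-subalgebra $\mathfrak B$ is a positive linear map $\mathbb E$ of norm $1$ from $\mathfrak A$ onto $\mathfrak B$ with $\mathbb E(bac)=b\,\mathbb E(a)\,c$ for all $b,c\in\mathfrak B$ and $a\in\mathfrak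 A$. **Theorem.** Let $\mathcal I=(\mathfrak A_n,\alpha_n)_{n\in\mathbb N}$ be an inductive sequence of finite-dimensional C*-algebras with unital injective *-morphisms $\alpha_n:\mathfrak A_n\to\mathfrak A_{n+1}$ and $\mathfrak A_0=\mathbb C$. Let $\mathfrak A$ be its C*-inductive limit, with canonical *-morphisms $\alpha^n:\mathfrak A_n\to\mathfrak A$, let $\mu$ be a faithful tracial state on the (unital AF) algebra $\mathfrak A$, and let $\beta:\mathbb N\to(0,\infty)$ have limit $0$. Then: 1. For every $n\in\mathbb N$ there is a unique conditional expectation $\mathbb E_n$ of $\mathfrak A$ onto $\alpha^n(\mathfrak A_n)$ such that $\mu\circ\mathbb E_n=\mu$. 2. With $\mathsf L(a)=\sup_{n\in\mathbb N}\frac{\|a-\mathbb E_n(a)\|_{\mathfrak A}}{\beta(n)}\in[0,\infty]$ for $a\in\mathfrak{sa}(\mathfrak A)$, the pair $(\mathfrak A,\mathsf L)$ is a $(2,0)$-quasi-Leibniz quantum compact metric space; that is, $\mathsf L$ is a lower semicontinuous $(2,0)$-quasi-Leibniz Lip-norm. 3. For every $n\in\mathbb N$, the pair $(\mathfrak A_n,\mathsf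 L\circ\alpha^n)$ is a $(2,0)$-quasi-Leibniz quantum compact metric space and $$\mathsf\Lambda\big((\mathfrak A_n,\mathsf L\circ\alpha^n),(\mathfrak A,\mathsf L)\big)\le\beta(n).$$ 4. Consequently $\lim_{n\to\infty}\mathsf\Lambda\big((\mathfrak A_n,\mathsf L\circ\alpha^n),(\mathfrak A,\mathsf L)\big)=0$. -/

import Mathlib

open Filter Topology
open scoped ENNReal NNReal ComplexOrder

universe u

noncomputable section

/-! ### States of a unital C*-algebra -/

/-- The state space `𝒮(A)`, inside the dual of `A` with its weak* topology:
the positive linear functionals that take the value `1` at the unit. -/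
def stateSpace (A : Type u) [CStarAlgebra A] : Set (WeakDual ℂ A) :=
  {φ | (∀ a : A, 0 ≤ φ (star a * a)) ∧ φ 1 = 1}

/-- A faithful tracial state. -/
structure IsFaithfulTracialState {A : Type u} [CStarAlgebra A] (μ : WeakDual ℂ A) : Prop where
  state : μ ∈ stateSpace A
  tracial : ∀ a b : A, μ (a * b) = μ (b * a)
  faithful : ∀ a : A, μ (star a * a) = 0 → a = 0

/-- The dual map `φ ↦ φ ∘ π` of a unital *-morphism (such a morphism is automatically bounded). -/
def dualMap {A B : Type u} [CStarAlgebra A] [CStarAlgebra B] (π : A →⋆ₐ[ℂ] B)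
    (φ : WeakDual ℂ B) : WeakDual ℂ A :=
  StrongDual.toWeakDual ((WeakDual.toStrongDual φ).comp
    { toLinearMap := (π : A →ₐ[ℂ] B).toLinearMap
      cont := AddMonoidHomClass.continuous_of_bound π 1 fun a => by
        simpa only [one_mul] using NonUnitalStarAlgHom.norm_apply_le π a })

/-! ### Self-adjoint elements -/

section SelfAdjoint

variable {A : Type u} [CStarAlgebra A]

/-- The Jordan product `(ab + ba) / 2` of two self-adjoint elements. -/
def jordanProd (a b : selfAdjoint A) : selfAdjoint A :=
  ⟨(2 : ℂ)⁻¹ • ((a : A) * b + b * a), by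
    simp [selfAdjoint.mem_iff, star_smul, add_comm]⟩

/-- The Lie product `(ab - ba) / (2i)` of two self-adjoint elements. -/
def lieProd (a b : selfAdjoint A) : selfAdjoint A :=
  ⟨(2 * Complex.I)⁻¹ • ((a : A) * b - b * a), by
    rw [selfAdjoint.mem_iff, star_smul, ← neg_sub ((b : A) * a), smul_neg, ← neg_smul]
    simp⟩

/-- The restriction of a unital *-morphism to the self-adjoint parts. -/
def saMap {B : Type u} [CStarAlgebra B] (π : A →⋆ₐ[ℂ] B) (a : selfAdjoint A) : selfAdjoint B :=
  ⟨π a, by rw [selfAdjoint.mem_iff, ← map_star, selfAdjoint.star_val_eq]⟩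

end SelfAdjoint

/-! ### Quasi-Leibniz quantum compact metric spaces

A seminorm `L` defined on a subspace of `sa(A)` is extended by `∞` to all of `sa(A)`, so that its
domain is `{a | L a < ∞}`. -/

section LipNorm

variable {A : Type u} [CStarAlgebra A]

/-- The Monge–Kantorovich metric
`mk_L(φ, ψ) = sup {|φ(a) - ψ(a)| : a ∈ sa(A), L(a) ≤ 1}`. -/
def mkDist (L : selfAdjoint A → ℝ≥0∞) (φ ψ : WeakDual ℂ A) : ℝ≥0∞ :=
  ⨆ (a : selfAdjoint A) (_ : L a ≤ 1), ‖φ (a : A) - ψ (a : A)‖ₑ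

/-- `mk_L` is a (finite) metric on the state space, and its topology is the weak* topology. -/
def MetrizesStateSpace (L : selfAdjoint A → ℝ≥0∞) : Prop :=
  ∃ m : MetricSpace (stateSpace A),
    (∀ φ ψ : stateSpace A, mkDist L φ ψ = ENNReal.ofReal (m.dist φ ψ)) ∧
    m.toUniformSpace.toTopologicalSpace = instTopologicalSpaceSubtype

/-- `(A, L)` is a `(C, D)`-quasi-Leibniz quantum compact metric space. By `add_le` and `smul`, the
domain of `L` is a real subspace of `sa(A)` on which `L` is a seminorm; by `jordan` and `lie` it
is closed under the Jordan and Lie products. -/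
structure IsQuasiLeibnizQCMS (C D : ℝ≥0) (L : selfAdjoint A → ℝ≥0∞) : Prop where
  one_le : 1 ≤ C
  nontrivial : Nontrivial A
  add_le : ∀ a b : selfAdjoint A, L (a + b) ≤ L a + L b
  smul : ∀ (t : ℝ) (a : selfAdjoint A), L (t • a) = ‖t‖ₑ * L a
  dense_dom : Dense {a : selfAdjoint A | L a < ∞}
  eq_zero_iff : ∀ a : selfAdjoint A, L a = 0 ↔ ∃ t : ℝ, a = t • (1 : selfAdjoint A)
  jordan : ∀ a b : selfAdjoint A, L a < ∞ → L b < ∞ →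
    L (jordanProd a b) ≤ C * (‖(a : A)‖ₑ * L b + ‖(b : A)‖ₑ * L a) + D * (L a * L b)
  lie : ∀ a b : selfAdjoint A, L a < ∞ → L b < ∞ →
    L (lieProd a b) ≤ C * (‖(a : A)‖ₑ * L b + ‖(b : A)‖ₑ * L a) + D * (L a * L b)
  metrizes : MetrizesStateSpace L
  lowerSemicontinuous : LowerSemicontinuous L

end LipNorm

/-- The class of all `(C, D)`-quasi-Leibniz quantum compact metric spaces. -/
structure QuasiLeibnizQCMS (C D : ℝ≥0) : Type (u + 1) where
  carrier : Type u
  [cstarAlgebra : CStarAlgebra carrier]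
  L : selfAdjoint carrier → ℝ≥0∞
  isQuasiLeibnizQCMS : IsQuasiLeibnizQCMS C D L

attribute [instance] QuasiLeibnizQCMS.cstarAlgebra

/-! ### Bridges and the quantum propinquity -/

/-- The Hausdorff distance between two sets for an (extended, pseudo-)distance `d`. -/
def hausdorff {X : Type u} (d : X → X → ℝ≥0∞) (S T : Set X) : ℝ≥0∞ :=
  max (⨆ x ∈ S, ⨅ y ∈ T, d x y) (⨆ y ∈ T, ⨅ x ∈ S, d x y)

/-- The `1`-level set of `ω`. -/
def levelSet {D : Type u} [CStarAlgebra D] (ω : D) : Set (WeakDual ℂ D) :=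
  {φ | φ ∈ stateSpace D ∧ φ (1 - star ω * ω) = 0 ∧ φ (1 - ω * star ω) = 0}

/-- A bridge from `A` to `B`. -/
structure Bridge (A B : Type u) [CStarAlgebra A] [CStarAlgebra B] : Type (u + 1) where
  space : Type u
  [cstarAlgebra : CStarAlgebra space]
  pivot : space
  left : A →⋆ₐ[ℂ] space
  right : B →⋆ₐ[ℂ] space
  levelSet_nonempty : (levelSet pivot).Nonempty
  left_injective : Function.Injective left
  right_injective : Function.Injective right

attribute [instance] Bridge.cstarAlgebra

namespace Bridge

variable {A B : Type u} [CStarAlgebra A] [CStarAlgebra B]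

/-- The bridge seminorm on `A ⊕ B`. -/
def seminorm (γ : Bridge A B) (p : A × B) : ℝ≥0∞ :=
  ‖γ.left p.1 * γ.pivot - γ.pivot * γ.right p.2‖ₑ

/-- The height of a bridge. -/
def height (γ : Bridge A B) (LA : selfAdjoint A → ℝ≥0∞) (LB : selfAdjoint B → ℝ≥0∞) : ℝ≥0∞ :=
  max (hausdorff (mkDist LA) (stateSpace A) (dualMap γ.left '' levelSet γ.pivot))
    (hausdorff (mkDist LB) (stateSpace B) (dualMap γ.right '' levelSet γ.pivot))

/-- The reach of a bridge: the Hausdorff distance between the two Lipschitz unit balls, viewed in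
`A ⊕ 0` and `0 ⊕ B`, for the bridge seminorm. -/
def reach (γ : Bridge A B) (LA : selfAdjoint A → ℝ≥0∞) (LB : selfAdjoint B → ℝ≥0∞) : ℝ≥0∞ :=
  hausdorff (fun p q : A × B => γ.seminorm (p - q))
    ((fun a : selfAdjoint A => ((a : A), (0 : B))) '' {a | LA a ≤ 1})
    ((fun b : selfAdjoint B => ((0 : A), (b : B))) '' {b | LB b ≤ 1})

/-- The length of a bridge. -/
def length (γ : Bridge A B) (LA : selfAdjoint A → ℝ≥0∞) (LB : selfAdjoint B → ℝ≥0∞) : ℝ≥0∞ :=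
  max (γ.height LA LB) (γ.reach LA LB)

end Bridge

/-- A trek from `X` to `Y`: a finite, nonempty chain of bridges that joins `X` to `Y` through
`(C, D)`-quasi-Leibniz quantum compact metric spaces. -/
inductive Trek {C D : ℝ≥0} :
    QuasiLeibnizQCMS.{u} C D → QuasiLeibnizQCMS.{u} C D → Type (u + 1)
  | single {X Y : QuasiLeibnizQCMS.{u} C D} (γ : Bridge X.carrier Y.carrier) : Trek X Y
  | cons {X Y Z : QuasiLeibnizQCMS.{u} C D} (γ : Bridge X.carrier Y.carrier) (t : Trek Y Z) :
      Trek X Z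

/-- The length of a trek is the sum of the lengths of its bridges. -/
def Trek.length {C D : ℝ≥0} :
    {X Y : QuasiLeibnizQCMS.{u} C D} → Trek X Y → ℝ≥0∞
  | X, Y, .single γ => γ.length X.L Y.L
  | X, _, .cons (Y := Y) γ t => γ.length X.L Y.L + t.length

/-- The quantum propinquity `Λ_{C,D}`: the infimum of the lengths of all treks, that is, the
largest pseudo-distance on the class of `(C, D)`-quasi-Leibniz quantum compact metric spaces that
is bounded above by the length of every bridge. -/
def propinquity {C D : ℝ≥0} (X Y : QuasiLeibnizQCMS.{u} C D) : ℝ≥0∞ :=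
  ⨅ t : Trek X Y, t.length

/-! ### Inductive sequences and conditional expectations -/

/-- The composite `α_{n+m-1} ∘ ⋯ ∘ α_n : A_n → A_{n+m}`. -/
def iterMap {A : ℕ → Type u} [∀ n, CStarAlgebra (A n)] (α : ∀ n, A n →⋆ₐ[ℂ] A (n + 1)) (n : ℕ) :
    (m : ℕ) → A n →⋆ₐ[ℂ] A (n + m)
  | 0 => StarAlgHom.id ℂ (A n)
  | m + 1 => (α (n + m)).comp (iterMap α n m)

/-- `B`, with the canonical morphisms `ι n : A n → B`, is the C*-inductive limit of `(A, α)`, that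
is, the completion of the algebraic direct limit for the C*-seminorm
`a ↦ lim_m ‖(α_{n+m-1} ∘ ⋯ ∘ α_n) a‖`, `a ∈ A n`. -/
structure IsCStarInductiveLimit {A : ℕ → Type u} [∀ n, CStarAlgebra (A n)]
    (α : ∀ n, A n →⋆ₐ[ℂ] A (n + 1)) {B : Type u} [CStarAlgebra B] (ι : ∀ n, A n →⋆ₐ[ℂ] B) :
    Prop where
  compat : ∀ n, (ι (n + 1)).comp (α n) = ι n
  norm_eq : ∀ n (a : A n), Tendsto (fun m => ‖iterMap α n m a‖) atTop (𝓝 ‖ι n a‖)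
  dense : Dense (⋃ n, Set.range (ι n))

/-- `E` is a conditional expectation of `A` onto the C*-subalgebra `B`. (The positive elements of a
C*-algebra are those of the form `star c * c`.) -/
structure IsConditionalExpectation {A : Type u} [CStarAlgebra A] (B : StarSubalgebra ℂ A)
    (E : A →L[ℂ] A) : Prop where
  range_eq : Set.range E = (B : Set A)
  positive : ∀ a : A, ∃ c : A, E (star a * a) = star c * c
  norm_eq_one : ‖E‖ = 1
  bimodule : ∀ b ∈ B, ∀ c ∈ B, ∀ a : A, E (b * a * c) = b * E a * c

/-- The seminorm `L(a) = sup_n ‖a - E_n(a)‖ / β(n)` on `sa(A)`, with value `∞` where the supremum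
is infinite. -/
def lipNorm {A : Type u} [CStarAlgebra A] (E : ℕ → A →L[ℂ] A) (β : ℕ → ℝ) :
    selfAdjoint A → ℝ≥0∞ :=
  fun a => ⨆ n, ENNReal.ofReal (‖(a : A) - E n a‖ / β n)

end

/-! ### Positive elements and states -/

section Positive

variable {A : Type u} [CStarAlgebra A]

/-! Faithfulness of the trace makes `μ (star a * b)` definite, so each finite-dimensional `A n` has
an orthogonal projection `F n` from the limit algebra (`IsTraceProjection`). Traciality makes `F n`
a positive contractive bimodule map, and `ι n ∘ F n` is the only trace-preserving expectation. The
expectations are nested, contractive and start with a scalar one (`IsExpectationSystem`). The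
Leibniz bound follows by comparing `a * b` with its expectation (`norm_mul_sub_le`). The Lipschitz
ball lies within `β 0` of the scalars and within `β n` of a finite-dimensional space, so the metric
induces the weak* topology (`metrizesStateSpace_of_approx`). For the propinquity a single bridge
with pivot `1` suffices. Its height is zero since states extend along `φ ↦ φ ∘ F n`. Its reach is at
most `β n` since `E n` does not increase the seminorm (`lipNorm_le_lipNorm`) and moves the unit ball
by at most `β n`. -/

theorem exists_star_mul_self_sub_of_isSelfAdjoint {a : A} (ha : IsSelfAdjoint a) :
    ∃ c d : A, a = star c * c - star d * d ∧ star c * c * (star d * d) = 0 := by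
  let := CStarAlgebra.spectralOrder A
  let := CStarAlgebra.spectralOrderedRing A
  obtain ⟨c, hc⟩ := CStarAlgebra.nonneg_iff_eq_star_mul_self.1 (CFC.posPart_nonneg a)
  obtain ⟨d, hd⟩ := CStarAlgebra.nonneg_iff_eq_star_mul_self.1 (CFC.negPart_nonneg a)
  exact ⟨c, d, by rw [← hc, ← hd, CFC.posPart_sub_negPart a ha], by
    rw [← hc, ← hd, CFC.posPart_mul_negPart]⟩

theorem exists_norm_sub_eq_star_mul_self {a : A} (ha : IsSelfAdjoint a) :
    ∃ c : A, (‖a‖ : ℂ) • (1 : A) - a = star c * c := by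
  let := CStarAlgebra.spectralOrder A
  let := CStarAlgebra.spectralOrderedRing A
  have h := ha.le_algebraMap_norm_self
  rw [← sub_nonneg, CStarAlgebra.nonneg_iff_eq_star_mul_self, Algebra.algebraMap_eq_smul_one] at h
  simpa only [Complex.coe_smul] using h

theorem exists_norm_sq_sub_eq_star_mul_self (a : A) :
    ∃ c : A, ((‖a‖ ^ 2 : ℝ) : ℂ) • (1 : A) - star a * a = star c * c := by
  let := CStarAlgebra.spectralOrder A
  let := CStarAlgebra.spectralOrderedRing A
  have h := CStarAlgebra.star_mul_le_algebraMap_norm_sq (a := a)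
  rw [← sub_nonneg, CStarAlgebra.nonneg_iff_eq_star_mul_self, Algebra.algebraMap_eq_smul_one] at h
  simpa only [Complex.coe_smul] using h

theorem norm_le_of_star_mul_self_add_eq {x y z : A} {r : ℝ} (hr : 0 ≤ r)
    (h : star x * x + star y * y + star z * z = ((r ^ 2 : ℝ) : ℂ) • (1 : A)) : ‖x‖ ≤ r := by
  let := CStarAlgebra.spectralOrder A
  let := CStarAlgebra.spectralOrderedRing A
  have h1 : star x * x ≤ algebraMap ℝ A (r ^ 2) := by
    rw [Algebra.algebraMap_eq_smul_one, ← Complex.coe_smul, ← h, add_assoc]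
    exact le_add_of_nonneg_right (add_nonneg (star_mul_self_nonneg y) (star_mul_self_nonneg z))
  have h2 := (CStarAlgebra.norm_le_iff_le_algebraMap (star x * x) (sq_nonneg r)
    (star_mul_self_nonneg x)).2 h1
  rw [CStarRing.norm_star_mul_self, ← sq] at h2
  exact le_of_sq_le_sq h2 hr

end Positive

section States

variable {A : Type u} [CStarAlgebra A] {φ : WeakDual ℂ A}

theorem stateSpace.norm_apply_le_of_isSelfAdjoint (hφ : φ ∈ stateSpace A) {a : A}
    (ha : IsSelfAdjoint a) : φ a = ((φ a).re : ℂ) ∧ ‖φ a‖ ≤ ‖a‖ := by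
  have key : ∀ b : A, IsSelfAdjoint b → (φ b).re ≤ ‖b‖ ∧ (φ b).im = 0 := fun b hb => by
    obtain ⟨c, hc⟩ := exists_norm_sub_eq_star_mul_self hb
    have h := hφ.1 c
    rw [← hc, map_sub, map_smul, hφ.2, Complex.le_def] at h
    have h1 := h.1
    have h2 := h.2
    simp at h1 h2
    exact ⟨h1, h2⟩
  have h1 := key a ha
  have h2 := key (-a) ha.neg
  rw [map_neg, norm_neg, Complex.neg_re] at h2
  have h3 : φ a = ((φ a).re : ℂ) := Complex.ext (by simp) (by simp [h1.2])
  refine ⟨h3, ?_⟩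
  rw [h3, Complex.norm_real, Real.norm_eq_abs, abs_le]
  exact ⟨by linarith [h2.1], h1.1⟩

open ComplexStarModule in
theorem stateSpace.apply_star (hφ : φ ∈ stateSpace A) (a : A) : φ (star a) = star (φ a) := by
  conv_lhs => rw [← realPart_add_I_smul_imaginaryPart a]
  conv_rhs => rw [← realPart_add_I_smul_imaginaryPart a]
  have h1 := (stateSpace.norm_apply_le_of_isSelfAdjoint hφ (ℜ a).2).1
  have h2 := (stateSpace.norm_apply_le_of_isSelfAdjoint hφ (ℑ a).2).1
  rw [star_add, star_smul, (ℜ a).2.star_eq, (ℑ a).2.star_eq, map_add, map_add, map_smul, map_smul,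
    h1, h2]
  simp

open ComplexStarModule in
-- The factor 2 comes from treating real and imaginary parts separately; the sharp constant 1 is not
-- needed.
theorem stateSpace.norm_apply_le (hφ : φ ∈ stateSpace A) (a : A) : ‖φ a‖ ≤ 2 * ‖a‖ := by
  have h1 := (stateSpace.norm_apply_le_of_isSelfAdjoint hφ (ℜ a).2).2
  have h2 := (stateSpace.norm_apply_le_of_isSelfAdjoint hφ (ℑ a).2).2
  have h3 := realPart.norm_le a
  have h4 := imaginaryPart.norm_le a
  calc ‖φ a‖ = ‖φ (ℜ a : A) + Complex.I • φ (ℑ a : A)‖ := by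
        rw [← map_smul, ← map_add, realPart_add_I_smul_imaginaryPart]
    _ ≤ ‖φ (ℜ a : A)‖ + ‖φ (ℑ a : A)‖ := by
        refine (norm_add_le _ _).trans ?_
        rw [norm_smul, Complex.norm_I, one_mul]
    _ ≤ 2 * ‖a‖ := by
        rw [← AddSubgroup.coe_norm] at h1 h2
        linarith

end States

/-! ### Trace-preserving conditional expectations onto finite-dimensional subalgebras -/

section Expectation

variable {A B : Type u} [CStarAlgebra A] [CStarAlgebra B]
  {i : A →⋆ₐ[ℂ] B} {μ : WeakDual ℂ B}

theorem IsFaithfulTracialState.eq_of_forall_apply_mul_eq (hμ : IsFaithfulTracialState μ)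
    (hi : Function.Injective i) {x y : A} (h : ∀ c, μ (i c * i x) = μ (i c * i y)) : x = y := by
  rw [← sub_eq_zero]
  apply hi
  rw [map_zero]
  apply hμ.faithful
  rw [← map_star, map_sub i x y, mul_sub, map_sub, h, sub_self]

/-- `F` is the orthogonal projection of `B` onto `A` for the inner product `μ (star a * b)`. -/
def IsTraceProjection (i : A →⋆ₐ[ℂ] B) (μ : WeakDual ℂ B) (F : B → A) : Prop :=
  ∀ c b, μ (i c * i (F b)) = μ (i c * b)

namespace IsTraceProjection

/-- The trace form embeds `A` in its dual, and equal dimensions make the embedding an isomorphism.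
Its inverse represents the functional `c ↦ μ (i c * b)` by an element of `A`. -/
theorem exists_linearMap [FiniteDimensional ℂ A] (hμ : IsFaithfulTracialState μ)
    (hi : Function.Injective i) : ∃ F : B →ₗ[ℂ] A, IsTraceProjection i μ F := by
  let S : B →ₗ[ℂ] Module.Dual ℂ A := LinearMap.mk₂ ℂ (fun b c => μ (i c * b))
    (fun b b' c => by rw [mul_add, map_add]) (fun z b c => by rw [mul_smul_comm, map_smul])
    (fun b c c' => by rw [map_add i, add_mul, map_add])
    (fun z b c => by rw [map_smul i, smul_mul_assoc, map_smul])
  let T : A →ₗ[ℂ] Module.Dual ℂ A := S ∘ₗ (i : A →ₐ[ℂ] B).toLinearMap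
  have hT : Function.Injective T := fun x y h =>
    hμ.eq_of_forall_apply_mul_eq hi fun c => LinearMap.congr_fun h c
  let e := LinearEquiv.ofInjectiveOfFinrankEq T hT Subspace.dual_finrank_eq.symm
  refine ⟨e.symm.toLinearMap ∘ₗ S, fun c b => ?_⟩
  exact LinearMap.congr_fun (e.apply_symm_apply (S b)) c

variable {F : B →ₗ[ℂ] A}

theorem apply_map (hF : IsTraceProjection i μ F) (hμ : IsFaithfulTracialState μ)
    (hi : Function.Injective i) (x : A) : F (i x) = x :=
  hμ.eq_of_forall_apply_mul_eq hi fun c => hF c (i x)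

theorem apply_mul (hF : IsTraceProjection i μ F) (hμ : IsFaithfulTracialState μ)
    (hi : Function.Injective i) (x y : A) (b : B) : F (i x * b * i y) = x * F b * y := by
  refine hμ.eq_of_forall_apply_mul_eq hi fun c => ?_
  calc μ (i c * i (F (i x * b * i y))) = μ (i (c * x) * b * i y) := by
        rw [hF, map_mul i c]; simp only [mul_assoc]
    _ = μ (i (y * (c * x)) * i (F b)) := by
        rw [hμ.tracial, hF, map_mul i y]; simp only [mul_assoc]
    _ = μ (i c * i (x * F b * y)) := by
        rw [map_mul i y, mul_assoc, hμ.tracial]; simp only [map_mul, mul_assoc]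

theorem apply_star (hF : IsTraceProjection i μ F) (hμ : IsFaithfulTracialState μ)
    (hi : Function.Injective i) (b : B) : F (star b) = star (F b) := by
  refine hμ.eq_of_forall_apply_mul_eq hi fun c => ?_
  have h := congrArg star (hF (star c) b)
  rw [← stateSpace.apply_star hμ.state, ← stateSpace.apply_star hμ.state, star_mul, star_mul,
    map_star, star_star, hμ.tracial, hμ.tracial _ (i c)] at h
  rw [hF, map_star, h]

/-- Let `q = star d * d` be the negative part of `F (star b * b)`. Testing against `q` gives `-μ (i
(q * q)) ≤ 0`, while traciality turns the same number into the trace of a positive element. Hence `μ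
(i (q * q)) = 0`, and faithfulness gives `q = 0`. -/
theorem apply_star_mul_self (hF : IsTraceProjection i μ F) (hμ : IsFaithfulTracialState μ)
    (hi : Function.Injective i) (b : B) : ∃ c, F (star b * b) = star c * c := by
  have hs : IsSelfAdjoint (F (star b * b)) := by
    rw [IsSelfAdjoint, ← hF.apply_star hμ hi, star_mul, star_star]
  obtain ⟨c, d, h, hcd⟩ := exists_star_mul_self_sub_of_isSelfAdjoint hs
  suffices hd : star d * d = 0 from ⟨c, by rw [h, hd, sub_zero]⟩
  have hdc : star d * d * (star c * c) = 0 := by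
    have := congrArg star hcd
    simpa [mul_assoc] using this
  have h1 : μ (i (star d * d) * (star b * b)) = - μ (star (i (star d * d)) * i (star d * d)) := by
    rw [← hF, h, ← map_mul i, mul_sub, hdc, zero_sub, map_neg, map_neg, map_mul i, ← map_star]
    simp only [star_mul, star_star]
  have h2 : μ (i (star d * d) * (star b * b)) =
      μ (star (b * star (i d)) * (b * star (i d))) := by
    rw [map_mul i, mul_assoc, hμ.tracial, star_mul, star_star, map_star]
    simp only [mul_assoc]
  have h3 := hμ.state.1 (b * star (i d))
  rw [← h2, h1, Left.nonneg_neg_iff] at h3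
  have h4 := hμ.faithful _ (le_antisymm h3 (hμ.state.1 _))
  exact hi (by rw [h4, map_zero])

/-- A Kadison–Schwarz argument: positivity of `F` on `star (b - i (F b)) * (b - i (F b))` bounds
`star (F b) * F b` by `F (star b * b)`, and positivity on `‖b‖ ^ 2 - star b * b` bounds that by `‖b‖
^ 2`. Continuity of `F` is a consequence, not an assumption. -/
theorem norm_apply_le (hF : IsTraceProjection i μ F) (hμ : IsFaithfulTracialState μ)
    (hi : Function.Injective i) (b : B) : ‖F b‖ ≤ ‖b‖ := by
  obtain ⟨c, hc⟩ := exists_norm_sq_sub_eq_star_mul_self b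
  obtain ⟨y, hy⟩ := hF.apply_star_mul_self hμ hi c
  obtain ⟨z, hz⟩ := hF.apply_star_mul_self hμ hi (b - i (F b))
  have h1 : F 1 = 1 := by simpa using hF.apply_map hμ hi 1
  have hl : ∀ x b, F (i x * b) = x * F b := fun x b => by
    simpa using hF.apply_mul hμ hi x 1 b
  have hr : ∀ x b, F (b * i x) = F b * x := fun x b => by
    simpa using hF.apply_mul hμ hi 1 x b
  refine norm_le_of_star_mul_self_add_eq (norm_nonneg b) (x := F b) (y := y) (z := z) ?_
  rw [← hy, ← hz, ← hc, map_sub, map_smul, h1, star_sub, ← map_star i, sub_mul, mul_sub, mul_sub,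
    map_sub, map_sub, map_sub, hl, hl, hr, hF.apply_star hμ hi, hF.apply_map hμ hi]
  abel

end IsTraceProjection

theorem IsFaithfulTracialState.exists_isTraceProjection [FiniteDimensional ℂ A]
    (hμ : IsFaithfulTracialState μ) (hi : Function.Injective i) :
    ∃ F : B →L[ℂ] A, IsTraceProjection i μ F := by
  obtain ⟨F, hF⟩ := IsTraceProjection.exists_linearMap hμ hi
  refine ⟨F.mkContinuous 1 fun b => ?_, hF⟩
  rw [one_mul]
  exact hF.norm_apply_le hμ hi b

theorem IsTraceProjection.isConditionalExpectation {F : B →L[ℂ] A}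
    (hF : IsTraceProjection i μ F) (hμ : IsFaithfulTracialState μ)
    (hi : Function.Injective i) {E : B →L[ℂ] B} (hE : ∀ b, E b = i (F b)) :
    IsConditionalExpectation i.range E ∧ ∀ b, μ (E b) = μ b := by
  have hF' : IsTraceProjection i μ (F : B →ₗ[ℂ] A) := hF
  have hFi : ∀ x, F (i x) = x := hF'.apply_map hμ hi
  refine ⟨⟨?_, fun a => ?_, le_antisymm ?_ ?_, ?_⟩, fun b => ?_⟩
  · ext b
    constructor
    · rintro ⟨a, rfl⟩
      exact ⟨F a, (hE a).symm⟩
    · rintro ⟨x, rfl⟩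
      refine ⟨i x, ?_⟩
      rw [hE, hFi]
      rfl
  · obtain ⟨c, hc⟩ := hF'.apply_star_mul_self hμ hi a
    refine ⟨i c, ?_⟩
    rw [hE, ← map_star, ← map_mul]
    exact congrArg i hc
  · refine E.opNorm_le_bound zero_le_one fun b => ?_
    rw [hE, one_mul]
    exact (NonUnitalStarAlgHom.norm_apply_le i _).trans (hF'.norm_apply_le hμ hi b)
  · have : Nontrivial B := ⟨1, 0, fun h => by
      have := hμ.state.2
      rw [h, map_zero] at this
      exact zero_ne_one this⟩
    have h1 : E 1 = 1 := by rw [hE, ← map_one i, hFi]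
    have := E.le_opNorm 1
    rwa [h1, norm_one, mul_one] at this
  · rintro _ ⟨x, rfl⟩ _ ⟨y, rfl⟩ a
    have := hF'.apply_mul hμ hi x y a
    rw [hE, hE]
    exact (congrArg i this).trans (by simp)
  · have := hF 1 b
    rwa [map_one, one_mul, one_mul, ← hE] at this

/-- The bimodule property and trace preservation give `μ (i c * E b) = μ (i c * b)`, the identity
that determines the projection. -/
theorem IsTraceProjection.eq_of_isConditionalExpectation {F : B → A}
    (hF : IsTraceProjection i μ F) (hμ : IsFaithfulTracialState μ)
    (hi : Function.Injective i) {E : B →L[ℂ] B} (hE : IsConditionalExpectation i.range E)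
    (hE' : ∀ b, μ (E b) = μ b) (b : B) : E b = i (F b) := by
  have h1 : E b ∈ (i.range : Set B) := hE.range_eq ▸ ⟨b, rfl⟩
  obtain ⟨x, hx⟩ := h1
  change i x = E b at hx
  rw [← hx]
  refine congrArg i (hμ.eq_of_forall_apply_mul_eq hi fun c => ?_)
  have h2 := hE.bimodule (i c) ⟨c, rfl⟩ 1 (one_mem _) b
  rw [mul_one, mul_one] at h2
  rw [hF, hx, ← h2, hE']

end Expectation

/-! ### The Monge–Kantorovich metric and the weak* topology -/

section Metrizes

variable {A : Type u} [CStarAlgebra A] {L : selfAdjoint A → ℝ≥0∞}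

theorem stateSpace.isCompact (A : Type u) [CStarAlgebra A] : IsCompact (stateSpace A) := by
  refine (WeakDual.isCompact_closedBall (0 : StrongDual ℂ A) 2).of_isClosed_subset ?_ fun φ hφ => ?_
  · have h : stateSpace A = (⋂ a : A, {φ | 0 ≤ φ (star a * a)}) ∩ {φ | φ 1 = 1} := by
      ext φ; simp [stateSpace]
    rw [h]
    refine (isClosed_iInter fun a => ?_).inter ?_
    · exact isClosed_Ici.preimage (WeakDual.eval_continuous (star a * a))
    · exact isClosed_singleton.preimage (WeakDual.eval_continuous (1 : A))
  · rw [Set.mem_preimage, mem_closedBall_zero_iff]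
    exact ContinuousLinearMap.opNorm_le_bound _ zero_le_two (stateSpace.norm_apply_le hφ)

theorem stateSpace.norm_apply_sub_le {φ ψ : WeakDual ℂ A} (hφ : φ ∈ stateSpace A)
    (hψ : ψ ∈ stateSpace A) (a : A) (z : ℂ) : ‖φ a - ψ a‖ ≤ 4 * ‖a - z • 1‖ := by
  have h1 := stateSpace.norm_apply_le hφ (a - z • 1)
  have h2 := stateSpace.norm_apply_le hψ (a - z • 1)
  calc ‖φ a - ψ a‖ = ‖φ (a - z • 1) - ψ (a - z • 1)‖ := by
        rw [map_sub, map_sub, map_smul, map_smul, hφ.2, hψ.2, sub_sub_sub_cancel_right]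
    _ ≤ _ := (norm_sub_le _ _).trans (by linarith)

theorem stateSpace.norm_apply_sub_lt {φ ψ : WeakDual ℂ A} (hφ : φ ∈ stateSpace A)
    (hψ : ψ ∈ stateSpace A) {a b : A} {r s : ℝ} (hab : ‖a - b‖ ≤ r) (h : ‖φ b - ψ b‖ < s) :
    ‖φ a - ψ a‖ < 4 * r + s := by
  have h1 := stateSpace.norm_apply_sub_le hφ hψ (a - b) 0
  rw [zero_smul, sub_zero] at h1
  calc ‖φ a - ψ a‖ = ‖(φ (a - b) - ψ (a - b)) + (φ b - ψ b)‖ := by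
        rw [map_sub, map_sub]; congr 1; ring
    _ < 4 * r + s := (norm_add_le _ _).trans_lt (by linarith)

set_option maxSynthPendingDepth 3 in
-- On a finite-dimensional space pointwise convergence is norm convergence, which makes weak*
-- closeness uniform over bounded subsets of `V`.
theorem stateSpace.eventually_norm_restrict_sub_lt (V : Submodule ℂ A) [FiniteDimensional ℂ V]
    (φ : stateSpace A) {δ : ℝ} (hδ : 0 < δ) :
    ∀ᶠ ψ : stateSpace A in 𝓝 φ, ‖(WeakDual.toStrongDual (ψ : WeakDual ℂ A)).comp V.subtypeL -
      (WeakDual.toStrongDual (φ : WeakDual ℂ A)).comp V.subtypeL‖ < δ := by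
  have h : Continuous fun ψ : stateSpace A =>
      (WeakDual.toStrongDual (ψ : WeakDual ℂ A)).comp V.subtypeL :=
    continuous_clm_apply.2 fun v =>
      (WeakDual.eval_continuous (v : A)).comp continuous_subtype_val
  have hn : Continuous fun f : V →L[ℂ] ℂ =>
      ‖f - (WeakDual.toStrongDual (φ : WeakDual ℂ A)).comp V.subtypeL‖ := by fun_prop
  refine ((hn.comp h).tendsto φ).eventually_lt_const ?_
  simpa using hδ

theorem mkDist_comm (φ ψ : WeakDual ℂ A) : mkDist L φ ψ = mkDist L ψ φ := by
  simp only [mkDist, enorm_sub_rev]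

theorem mkDist_self (φ : WeakDual ℂ A) : mkDist L φ φ = 0 := by
  simp [mkDist]

theorem mkDist_triangle (φ ψ χ : WeakDual ℂ A) :
    mkDist L φ χ ≤ mkDist L φ ψ + mkDist L ψ χ := by
  refine iSup₂_le fun a ha => ?_
  calc ‖φ (a : A) - χ (a : A)‖ₑ = ‖(φ (a : A) - ψ (a : A)) + (ψ (a : A) - χ (a : A))‖ₑ := by
        rw [sub_add_sub_cancel]
    _ ≤ ‖φ (a : A) - ψ (a : A)‖ₑ + ‖ψ (a : A) - χ (a : A)‖ₑ := enorm_add_le _ _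
    _ ≤ _ := add_le_add (le_iSup₂ (f := fun (a : selfAdjoint A) (_ : L a ≤ 1) =>
        ‖φ (a : A) - ψ (a : A)‖ₑ) a ha) (le_iSup₂ (f := fun (a : selfAdjoint A) (_ : L a ≤ 1) =>
        ‖ψ (a : A) - χ (a : A)‖ₑ) a ha)

theorem mkDist_le_ofReal {φ ψ : WeakDual ℂ A} {r : ℝ}
    (h : ∀ a : selfAdjoint A, L a ≤ 1 → ‖φ (a : A) - ψ (a : A)‖ ≤ r) :
    mkDist L φ ψ ≤ ENNReal.ofReal r :=
  iSup₂_le fun a ha => by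
    rw [← ofReal_norm]
    exact ENNReal.ofReal_le_ofReal (h a ha)

theorem apply_eq_of_mkDist_eq_zero (hsmul : ∀ (t : ℝ) (a : selfAdjoint A), L (t • a) = ‖t‖ₑ * L a)
    {φ ψ : WeakDual ℂ A} (h : mkDist L φ ψ = 0) {a : selfAdjoint A} (ha : L a < ∞) :
    φ (a : A) = ψ (a : A) := by
  -- Rescale `a` into the unit ball; the `+ 1` covers `L a = 0`.
  obtain ⟨t, ht, hta⟩ : ∃ t : ℝ, t ≠ 0 ∧ L (t • a) ≤ 1 := by
    refine ⟨((L a).toReal + 1)⁻¹, by positivity, ?_⟩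
    have hpos : 0 < (L a).toReal + 1 := by positivity
    rw [hsmul, ← ENNReal.ofReal_toReal ha.ne, Real.enorm_of_nonneg (by positivity),
      ← ENNReal.ofReal_mul (by positivity), ENNReal.ofReal_le_one,
      ENNReal.toReal_ofReal ENNReal.toReal_nonneg, inv_mul_le_iff₀ hpos]
    linarith
  have h0 : ‖φ ((t • a : selfAdjoint A) : A) - ψ ((t • a : selfAdjoint A) : A)‖ₑ ≤ 0 :=
    h ▸ le_iSup₂ (f := fun (a : selfAdjoint A) (_ : L a ≤ 1) =>
      ‖φ (a : A) - ψ (a : A)‖ₑ) (t • a) hta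
  rw [nonpos_iff_eq_zero, enorm_eq_zero, selfAdjoint.val_smul, ← Complex.coe_smul, map_smul,
    map_smul, ← smul_sub, smul_eq_zero] at h0
  exact sub_eq_zero.1 (h0.resolve_left (by exact_mod_cast ht))

open ComplexStarModule in
theorem WeakDual.ext_of_dense_selfAdjoint {s : Set (selfAdjoint A)} (hs : Dense s)
    {φ ψ : WeakDual ℂ A} (h : ∀ a ∈ s, φ (a : A) = ψ (a : A)) : φ = ψ := by
  have h1 : ∀ a : selfAdjoint A, φ (a : A) = ψ (a : A) := fun a =>
    congrFun (Continuous.ext_on hs (φ.cont.comp continuous_subtype_val)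
      (ψ.cont.comp continuous_subtype_val) h) a
  refine DFunLike.ext _ _ fun a => ?_
  rw [← realPart_add_I_smul_imaginaryPart a, map_add, map_add, map_smul, map_smul, h1, h1]

/-- A seminorm metrizes the state space if its unit ball is, up to constants, bounded and
approximately finite-dimensional. -/
theorem metrizesStateSpace_of_approx
    (hsmul : ∀ (t : ℝ) (a : selfAdjoint A), L (t • a) = ‖t‖ₑ * L a)
    (hdense : Dense {a : selfAdjoint A | L a < ∞}) {R : ℝ}
    (hR : ∀ a : selfAdjoint A, L a ≤ 1 → ∃ z : ℂ, ‖(a : A) - z • 1‖ ≤ R)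
    (happrox : ∀ ε > 0, ∃ V : Submodule ℂ A, FiniteDimensional ℂ V ∧ (1 : A) ∈ V ∧
      ∀ a : selfAdjoint A, L a ≤ 1 → ∃ v ∈ V, ‖(a : A) - v‖ ≤ ε) :
    MetrizesStateSpace L := by
  have hfin : ∀ φ ψ : stateSpace A, mkDist L φ ψ ≠ ∞ := fun φ ψ => by
    refine ((mkDist_le_ofReal (r := 4 * R) fun a ha => ?_).trans_lt ENNReal.ofReal_lt_top).ne
    obtain ⟨z, hz⟩ := hR a ha
    exact (stateSpace.norm_apply_sub_le φ.2 ψ.2 a z).trans (by linarith)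
  let m : MetricSpace (stateSpace A) :=
    { dist := fun φ ψ => (mkDist L φ ψ).toReal
      dist_self := fun φ => by simp [mkDist_self]
      dist_comm := fun φ ψ => by rw [mkDist_comm]
      dist_triangle := fun φ ψ χ => by
        rw [← ENNReal.toReal_add (hfin _ _) (hfin _ _)]
        exact ENNReal.toReal_mono (ENNReal.add_ne_top.2 ⟨hfin _ _, hfin _ _⟩)
          (mkDist_triangle _ _ _)
      eq_of_dist_eq_zero := fun {φ ψ} h => by
        have h0 := (ENNReal.toReal_eq_zero_iff _).1 h
        exact Subtype.ext (WeakDual.ext_of_dense_selfAdjoint hdense fun a ha =>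
          apply_eq_of_mkDist_eq_zero hsmul (h0.resolve_right (hfin _ _)) ha) }
  refine ⟨m, fun φ ψ => (ENNReal.ofReal_toReal (hfin φ ψ)).symm, ?_⟩
  let tw : TopologicalSpace (stateSpace A) := instTopologicalSpaceSubtype
  let tm : TopologicalSpace (stateSpace A) := m.toUniformSpace.toTopologicalSpace
  have hcont : @Continuous _ _ tw tm id := by
    rw [@continuous_iff_continuousAt _ _ tw tm]
    intro φ
    apply (@Metric.tendsto_nhds _ _ m.toPseudoMetricSpace (@nhds _ tw φ) id φ).2
    intro ε hε
    -- Replacing `a` by `v` costs `4 * (ε / 16) = ε / 4`. The choice of `δ` keeps the contribution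
    -- of `v` below `ε / 4`, since subtracting a scalar leaves norm at most `|R| + ε / 16`. The
    -- total is `ε / 2`.
    obtain ⟨V, hV, h1V, hVapprox⟩ := happrox (ε / 16) (by positivity)
    have hδ : 0 < ε / (4 * (|R| + ε / 16 + 1)) := by positivity
    filter_upwards [stateSpace.eventually_norm_restrict_sub_lt V φ hδ] with ψ hψ
    change (mkDist L (ψ : WeakDual ℂ A) φ).toReal < ε
    refine (ENNReal.toReal_le_of_le_ofReal (b := ε / 2) (by positivity)
      (mkDist_le_ofReal fun a ha => ?_)).trans_lt (half_lt_self hε)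
    obtain ⟨v, hv, hav⟩ := hVapprox a ha
    obtain ⟨z, hz⟩ := hR a ha
    have h2 : ‖v - z • 1‖ ≤ |R| + ε / 16 := by
      calc ‖v - z • 1‖ = ‖((a : A) - z • 1) - ((a : A) - v)‖ := by congr 1; abel
        _ ≤ R + ε / 16 := (norm_sub_le _ _).trans (add_le_add hz hav)
        _ ≤ _ := by gcongr; exact le_abs_self R
    have h3 := ContinuousLinearMap.le_opNorm
      ((WeakDual.toStrongDual (ψ : WeakDual ℂ A)).comp V.subtypeL -
        (WeakDual.toStrongDual (φ : WeakDual ℂ A)).comp V.subtypeL)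
      ⟨v - z • 1, V.sub_mem hv (V.smul_mem z h1V)⟩
    have h4 : ‖(ψ : WeakDual ℂ A) v - (φ : WeakDual ℂ A) v‖ < ε / 4 := by
      calc ‖(ψ : WeakDual ℂ A) v - (φ : WeakDual ℂ A) v‖
          = ‖(ψ : WeakDual ℂ A) (v - z • 1) - (φ : WeakDual ℂ A) (v - z • 1)‖ := by
            rw [map_sub, map_sub, map_smul, map_smul, ψ.2.2, φ.2.2, sub_sub_sub_cancel_right]
        _ ≤ _ * ‖v - z • 1‖ := h3
        _ ≤ ε / (4 * (|R| + ε / 16 + 1)) * (|R| + ε / 16) :=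
            mul_le_mul hψ.le h2 (norm_nonneg _) hδ.le
        _ < ε / (4 * (|R| + ε / 16 + 1)) * (|R| + ε / 16 + 1) :=
            mul_lt_mul_of_pos_left (lt_add_one _) hδ
        _ = ε / 4 := by field_simp
    exact (stateSpace.norm_apply_sub_lt ψ.2 φ.2 hav h4).le.trans (by linarith)
  -- A continuous bijection from a compact space to a Hausdorff one is a homeomorphism, so the
  -- reverse comparison of topologies is free.
  have hcomp : @CompactSpace _ tw := isCompact_iff_compactSpace.1 (stateSpace.isCompact A)
  have hT2 : ∀ (X : Type u) [MetricSpace X], T2Space X := fun X _ => inferInstance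
  let e := @Continuous.homeoOfEquivCompactToT2 _ _ tw tm hcomp (@hT2 _ m) (Equiv.refl _) hcont
  refine le_antisymm ?_ ?_
  · exact continuous_id_iff_le.1 (@Homeomorph.continuous _ _ tm tw (@Homeomorph.symm _ _ tw tm e))
  · exact continuous_id_iff_le.1 hcont

end Metrizes

/-! ### Lip-norms from nested conditional expectations -/

/-- A nested sequence of contractive conditional expectations with finite-dimensional ranges, the
first of them scalar, whose ranges exhaust a dense subset of `B`. -/
structure IsExpectationSystem {B : Type u} [CStarAlgebra B] (E : ℕ → B →L[ℂ] B) : Prop where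
  norm_le : ∀ n b, ‖E n b‖ ≤ ‖b‖
  apply_one : ∀ n, E n 1 = 1
  apply_star : ∀ n b, E n (star b) = star (E n b)
  apply_mul : ∀ n a b, E n (a * E n b) = E n a * E n b
  apply_apply_of_le : ∀ k n, k ≤ n → ∀ b, E k (E n b) = E k b ∧ E n (E k b) = E k b
  scalar : ∀ b, ∃ z : ℂ, E 0 b = z • 1
  finiteDimensional : ∀ n, FiniteDimensional ℂ (E n).range
  dense : Dense {b | ∃ n, E n b = b}

section LipNormExpectation

variable {B : Type u} [CStarAlgebra B] {E : ℕ → B →L[ℂ] B} {β : ℕ → ℝ}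

theorem lipNorm_le_ofReal (hβ : ∀ n, 0 < β n) {a : selfAdjoint B} {r : ℝ}
    (h : ∀ n, ‖(a : B) - E n a‖ ≤ r * β n) : lipNorm E β a ≤ ENNReal.ofReal r :=
  iSup_le fun n => ENNReal.ofReal_le_ofReal ((div_le_iff₀ (hβ n)).2 (h n))

theorem norm_sub_le_of_lipNorm_le (hβ : ∀ n, 0 < β n) {a : selfAdjoint B} {r : ℝ} (hr : 0 ≤ r)
    (h : lipNorm E β a ≤ ENNReal.ofReal r) (n : ℕ) : ‖(a : B) - E n a‖ ≤ r * β n := by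
  have h1 := (le_iSup (fun n => ENNReal.ofReal (‖(a : B) - E n a‖ / β n)) n).trans h
  rwa [ENNReal.ofReal_le_ofReal_iff hr, div_le_iff₀ (hβ n)] at h1

theorem norm_sub_le_of_lipNorm_le_one (hβ : ∀ n, 0 < β n) {a : selfAdjoint B}
    (h : lipNorm E β a ≤ 1) (n : ℕ) : ‖(a : B) - E n a‖ ≤ β n := by
  simpa using norm_sub_le_of_lipNorm_le hβ zero_le_one (h.trans_eq ENNReal.ofReal_one.symm) n

theorem lipNorm_add_le (hβ : ∀ n, 0 < β n) (a b : selfAdjoint B) :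
    lipNorm E β (a + b) ≤ lipNorm E β a + lipNorm E β b := by
  refine iSup_le fun n => ?_
  have h : ‖((a + b : selfAdjoint B) : B) - E n ((a + b : selfAdjoint B) : B)‖ / β n ≤
      ‖(a : B) - E n a‖ / β n + ‖(b : B) - E n b‖ / β n := by
    rw [← add_div]
    refine div_le_div_of_nonneg_right ?_ (hβ n).le
    rw [AddSubgroup.coe_add, map_add, add_sub_add_comm]
    exact norm_add_le _ _
  refine (ENNReal.ofReal_le_ofReal h).trans (ENNReal.ofReal_add_le.trans (add_le_add ?_ ?_))
  · exact le_iSup (fun n => ENNReal.ofReal (‖(a : B) - E n a‖ / β n)) n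
  · exact le_iSup (fun n => ENNReal.ofReal (‖(b : B) - E n b‖ / β n)) n

theorem lipNorm_smul (t : ℝ) (a : selfAdjoint B) :
    lipNorm E β (t • a) = ‖t‖ₑ * lipNorm E β a := by
  simp only [lipNorm, ENNReal.mul_iSup]
  refine iSup_congr fun n => ?_
  rw [selfAdjoint.val_smul, ← Complex.coe_smul, map_smul, ← smul_sub, norm_smul, Complex.norm_real,
    mul_div_assoc, ENNReal.ofReal_mul (norm_nonneg t), ofReal_norm]

theorem lowerSemicontinuous_lipNorm : LowerSemicontinuous (lipNorm E β) := by
  refine lowerSemicontinuous_iSup fun n => Continuous.lowerSemicontinuous ?_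
  exact ENNReal.continuous_ofReal.comp (by fun_prop)

theorem lipNorm_le_of_norm_sub_le (hβ : ∀ n, 0 < β n) {a b c : selfAdjoint B}
    (ha : lipNorm E β a < ∞) (hb : lipNorm E β b < ∞)
    (h : ∀ n, ‖(c : B) - E n c‖ ≤
      2 * (‖(a : B)‖ * ‖(b : B) - E n b‖ + ‖(b : B)‖ * ‖(a : B) - E n a‖)) :
    lipNorm E β c ≤ (2 : ℝ≥0) * (‖(a : B)‖ₑ * lipNorm E β b + ‖(b : B)‖ₑ * lipNorm E β a) +
      (0 : ℝ≥0) * (lipNorm E β a * lipNorm E β b) := by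
  have ha' := norm_sub_le_of_lipNorm_le hβ ENNReal.toReal_nonneg
    (ENNReal.ofReal_toReal ha.ne).ge
  have hb' := norm_sub_le_of_lipNorm_le hβ ENNReal.toReal_nonneg
    (ENNReal.ofReal_toReal hb.ne).ge
  set la := (lipNorm E β a).toReal
  set lb := (lipNorm E β b).toReal
  have h1 : lipNorm E β c ≤ ENNReal.ofReal (2 * (‖(a : B)‖ * lb + ‖(b : B)‖ * la)) := by
    refine lipNorm_le_ofReal hβ fun n => (h n).trans ?_
    have h2 := mul_le_mul_of_nonneg_left (hb' n) (norm_nonneg (a : B))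
    have h3 := mul_le_mul_of_nonneg_left (ha' n) (norm_nonneg (b : B))
    linarith
  refine h1.trans_eq ?_
  rw [ENNReal.coe_zero, zero_mul, add_zero, ENNReal.ofReal_mul zero_le_two,
    ENNReal.ofReal_add (by positivity) (by positivity), ENNReal.ofReal_mul (norm_nonneg _),
    ENNReal.ofReal_mul (norm_nonneg _), ofReal_norm, ofReal_norm, ENNReal.ofReal_toReal ha.ne,
    ENNReal.ofReal_toReal hb.ne]
  simp

namespace IsExpectationSystem

/-- The element `b` is replaced by `E n b` twice, once outside and once inside `E n`, hence the
factor 2 on that term only. -/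
theorem norm_mul_sub_le (hE : IsExpectationSystem E) (n : ℕ) (a b : B) :
    ‖a * b - E n (a * b)‖ ≤ 2 * (‖a‖ * ‖b - E n b‖) + ‖b‖ * ‖a - E n a‖ := by
  have h : a * b - E n (a * b) =
      (a * (b - E n b) + (a - E n a) * E n b) + E n (a * (E n b - b)) := by
    rw [mul_sub a (E n b), map_sub, hE.apply_mul]; noncomm_ring
  have h1 : ‖E n (a * (E n b - b))‖ ≤ ‖a‖ * ‖b - E n b‖ := by
    rw [norm_sub_rev b]
    exact (hE.norm_le n _).trans (norm_mul_le _ _)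
  have h2 : ‖(a - E n a) * E n b‖ ≤ ‖b‖ * ‖a - E n a‖ := by
    rw [mul_comm ‖b‖]
    exact (norm_mul_le _ _).trans (mul_le_mul_of_nonneg_left (hE.norm_le n b) (norm_nonneg _))
  have h3 := norm_mul_le a (b - E n b)
  rw [h]
  exact (norm_add₃_le).trans (by linarith)

/-- Nestedness kills all terms with index at least `m`, leaving finitely many. -/
theorem lipNorm_lt_top (hE : IsExpectationSystem E) {m : ℕ} {a : selfAdjoint B}
    (ha : E m a = a) : lipNorm E β a < ∞ := by
  have h : lipNorm E β a ≤
      ∑ n ∈ Finset.range m, ENNReal.ofReal (‖(a : B) - E n a‖ / β n) := by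
    refine iSup_le fun n => ?_
    rcases lt_or_ge n m with hn | hn
    · exact Finset.single_le_sum (f := fun n => ENNReal.ofReal (‖(a : B) - E n a‖ / β n))
        (fun _ _ => zero_le) (Finset.mem_range.2 hn)
    · have h0 := (hE.apply_apply_of_le m n hn a).2
      rw [ha] at h0
      simp [h0]
  exact h.trans_lt (ENNReal.sum_lt_top.2 fun _ _ => ENNReal.ofReal_lt_top)

/-- For `k ≤ n` the expectations commute and `E n` is contractive; for `k ≥ n` the `k`-th term of
`b` vanishes. -/
theorem lipNorm_le_lipNorm (hE : IsExpectationSystem E) (hβ : ∀ n, 0 < β n)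
    {n : ℕ} {a b : selfAdjoint B}
    (hab : (b : B) = E n a) : lipNorm E β b ≤ lipNorm E β a := by
  refine iSup_mono fun k => ENNReal.ofReal_le_ofReal ?_
  refine div_le_div_of_nonneg_right ?_ (hβ k).le
  rw [hab]
  rcases le_total k n with h | h
  · obtain ⟨h1, h2⟩ := hE.apply_apply_of_le k n h a
    calc ‖E n a - E k (E n a)‖ = ‖E n (a - E k a)‖ := by rw [h1, map_sub, h2]
      _ ≤ _ := hE.norm_le n _
  · rw [(hE.apply_apply_of_le n k h a).2, sub_self, norm_zero]
    exact norm_nonneg _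

theorem lipNorm_eq_zero_iff (hE : IsExpectationSystem E) (hβ : ∀ n, 0 < β n) (a : selfAdjoint B) :
    lipNorm E β a = 0 ↔ ∃ t : ℝ, a = t • (1 : selfAdjoint B) := by
  constructor
  · intro h
    have h0 := norm_sub_le_of_lipNorm_le hβ le_rfl (by rw [h]; exact zero_le) 0
    rw [zero_mul, norm_le_zero_iff, sub_eq_zero] at h0
    obtain ⟨z, hz⟩ := hE.scalar a
    rw [hz] at h0
    -- The scalar `z` need not be shown real: adding `a = z • 1` to its adjoint identity gives `2 •
    -- a = 2 • (z.re • 1)`.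
    refine ⟨z.re, Subtype.ext ?_⟩
    have h1 : (a : B) = star z • 1 := by
      have := congrArg star h0
      rwa [star_smul, star_one, selfAdjoint.star_val_eq] at this
    have h2 : (2 : ℂ) • (a : B) = (2 : ℂ) • ((z.re : ℂ) • (1 : B)) := by
      rw [two_smul]
      nth_rewrite 1 [h0]
      rw [h1, ← add_smul, smul_smul]
      congr 1
      exact Complex.add_conj z |>.trans (by push_cast; ring)
    have h3 := smul_right_injective B (two_ne_zero (α := ℂ)) h2
    rw [h3, selfAdjoint.val_smul, selfAdjoint.val_one, Complex.coe_smul]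
  · rintro ⟨t, rfl⟩
    rw [lipNorm_smul]
    have h1 : lipNorm E β 1 = 0 := by
      simp [lipNorm, hE.apply_one]
    rw [h1, mul_zero]

open ComplexStarModule in
-- The real part is a continuous surjection and, as `E n` commutes with the star, carries the dense
-- set of fixed elements into the domain.
theorem dense_lipNorm_lt_top (hE : IsExpectationSystem E) :
    Dense {a : selfAdjoint B | lipNorm E β a < ∞} := by
  have hc : Continuous (realPart : B → selfAdjoint B) :=
    AddMonoidHomClass.continuous_of_bound (realPart : B →ₗ[ℝ] selfAdjoint B) 1 fun x => by
      rw [one_mul]; exact realPart.norm_le x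
  have hs : Function.Surjective (realPart : B → selfAdjoint B) := realPart_surjective
  refine (hs.denseRange.dense_image hc hE.dense).mono ?_
  rintro _ ⟨b, ⟨n, hn⟩, rfl⟩
  refine hE.lipNorm_lt_top (m := n) ?_
  rw [realPart_apply_coe, ← Complex.coe_smul, map_smul, map_add, hE.apply_star, hn]

theorem exists_norm_sub_smul_le (hE : IsExpectationSystem E) (hβ : ∀ n, 0 < β n) {a : selfAdjoint B}
    (ha : lipNorm E β a ≤ 1) : ∃ z : ℂ, ‖(a : B) - z • 1‖ ≤ β 0 := by
  obtain ⟨z, hz⟩ := hE.scalar a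
  exact ⟨z, hz ▸ norm_sub_le_of_lipNorm_le_one hβ ha 0⟩

theorem isQuasiLeibnizQCMS_lipNorm [Nontrivial B]
    (hE : IsExpectationSystem E) (hβ : ∀ n, 0 < β n) (hβ0 : Tendsto β atTop (𝓝 0)) :
    IsQuasiLeibnizQCMS 2 0 (lipNorm E β) where
  one_le := one_le_two
  nontrivial := inferInstance
  add_le := lipNorm_add_le hβ
  smul := lipNorm_smul
  dense_dom := hE.dense_lipNorm_lt_top
  eq_zero_iff := hE.lipNorm_eq_zero_iff hβ
  jordan a b ha hb := by
    refine lipNorm_le_of_norm_sub_le hβ ha hb fun n => ?_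
    have h1 := hE.norm_mul_sub_le n (a : B) b
    have h2 := hE.norm_mul_sub_le n (b : B) a
    -- The two orders of multiplication together give each term a factor 3, halved to 3/2;
    -- nonnegativity relaxes this to 2.
    have h3 : 0 ≤ ‖(a : B)‖ * ‖(b : B) - E n b‖ := by positivity
    have h4 : 0 ≤ ‖(b : B)‖ * ‖(a : B) - E n a‖ := by positivity
    have h5 := norm_add_le ((a : B) * b - E n (a * b)) ((b : B) * a - E n (b * a))
    rw [jordanProd, map_smul, ← smul_sub, norm_smul, map_add, add_sub_add_comm]
    norm_num
    linarith
  lie a b ha hb := by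
    refine lipNorm_le_of_norm_sub_le hβ ha hb fun n => ?_
    have h1 := hE.norm_mul_sub_le n (a : B) b
    have h2 := hE.norm_mul_sub_le n (b : B) a
    have h3 : 0 ≤ ‖(a : B)‖ * ‖(b : B) - E n b‖ := by positivity
    have h4 : 0 ≤ ‖(b : B)‖ * ‖(a : B) - E n a‖ := by positivity
    have h5 := norm_sub_le ((a : B) * b - E n (a * b)) ((b : B) * a - E n (b * a))
    rw [lieProd, map_smul, ← smul_sub, norm_smul, map_sub, sub_sub_sub_comm]
    norm_num
    linarith
  metrizes := by
    refine metrizesStateSpace_of_approx lipNorm_smul hE.dense_lipNorm_lt_top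
      (fun a ha => hE.exists_norm_sub_smul_le hβ ha) fun ε hε => ?_
    obtain ⟨n, hn⟩ := (hβ0.eventually_le_const hε).exists
    exact ⟨(E n).range, hE.finiteDimensional n, ⟨1, hE.apply_one n⟩, fun a ha =>
      ⟨E n a, ⟨a, rfl⟩, (norm_sub_le_of_lipNorm_le_one hβ ha n).trans hn⟩⟩
  lowerSemicontinuous := lowerSemicontinuous_lipNorm

end IsExpectationSystem

end LipNormExpectation

/-! ### Restriction of a Lip-norm to a finite-dimensional subalgebra -/

section Restriction

variable {A B : Type u} [CStarAlgebra A] [CStarAlgebra B] {i : A →⋆ₐ[ℂ] B}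

theorem IsQuasiLeibnizQCMS.comp_saMap [FiniteDimensional ℂ A] {C D : ℝ≥0}
    {L : selfAdjoint B → ℝ≥0∞} (hL : IsQuasiLeibnizQCMS C D L) (hi : Function.Injective i)
    (hfin : ∀ a, L (saMap i a) < ∞) {R : ℝ}
    (hR : ∀ a, L a ≤ 1 → ∃ z : ℂ, ‖(a : B) - z • 1‖ ≤ R) :
    IsQuasiLeibnizQCMS C D (L ∘ saMap i) := by
  have hnorm : ∀ a, ‖i a‖ = ‖a‖ := NonUnitalStarAlgHom.norm_map i hi
  have henorm : ∀ a : selfAdjoint A, ‖(saMap i a : B)‖ₑ = ‖(a : A)‖ₑ := fun a => by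
    rw [← ofReal_norm, ← ofReal_norm]
    exact congrArg ENNReal.ofReal (hnorm a)
  have hsmul' : ∀ (t : ℝ) (a : selfAdjoint A), saMap i (t • a) = t • saMap i a := fun t a =>
    Subtype.ext (by
      simp only [saMap, selfAdjoint.val_smul, ← Complex.coe_smul]
      exact map_smul i (t : ℂ) (a : A))
  have hsmul : ∀ (t : ℝ) (a : selfAdjoint A),
      (L ∘ saMap i) (t • a) = ‖t‖ₑ * (L ∘ saMap i) a := fun t a => by
    rw [Function.comp_apply, hsmul', hL.smul, Function.comp_apply]
  have hdense : Dense {a : selfAdjoint A | (L ∘ saMap i) a < ∞} := by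
    have h : {a : selfAdjoint A | (L ∘ saMap i) a < ∞} = Set.univ := Set.eq_univ_of_forall hfin
    rw [h]
    exact dense_univ
  have hone : saMap i 1 = 1 := Subtype.ext (map_one i)
  have hinj : Function.Injective (saMap i) := fun a b h =>
    Subtype.ext (hi (congrArg Subtype.val h))
  refine ⟨hL.one_le, ?_, fun a b => ?_, hsmul, hdense, fun a => ?_, fun a b ha hb => ?_,
    fun a b ha hb => ?_, ?_, ?_⟩
  · have := hL.nontrivial
    exact i.toRingHom.domain_nontrivial
  · have h : saMap i (a + b) = saMap i a + saMap i b := Subtype.ext (map_add i (a : A) b)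
    rw [Function.comp_apply, h]
    exact hL.add_le _ _
  · rw [Function.comp_apply, hL.eq_zero_iff]
    refine exists_congr fun t => ?_
    rw [← hone, ← hsmul', hinj.eq_iff]
  · have h : saMap i (jordanProd a b) = jordanProd (saMap i a) (saMap i b) :=
      Subtype.ext (by simp [saMap, jordanProd])
    have h1 := hL.jordan _ _ ha hb
    rwa [← h, henorm a, henorm b] at h1
  · have h : saMap i (lieProd a b) = lieProd (saMap i a) (saMap i b) :=
      Subtype.ext (by simp [saMap, lieProd])
    have h1 := hL.lie _ _ ha hb
    rwa [← h, henorm a, henorm b] at h1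
  -- Finite dimension allows `V = ⊤`, with zero error; the radius `R` pulls back because `i` is
  -- isometric.
  · refine metrizesStateSpace_of_approx hsmul hdense (R := R) (fun a ha => ?_) fun ε hε =>
      ⟨⊤, inferInstance, trivial, fun a _ => ⟨a, trivial, by rw [sub_self, norm_zero]; exact hε.le⟩⟩
    obtain ⟨z, hz⟩ := hR _ ha
    refine ⟨z, ?_⟩
    rw [← hnorm, map_sub, map_smul, map_one]
    exact hz
  · exact LowerSemicontinuous.comp hL.lowerSemicontinuous (Continuous.subtype_mk
      ((AddMonoidHomClass.isometry_of_norm i hnorm).continuous.comp continuous_subtype_val) _)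

end Restriction

/-! ### The bridge of a unital embedding -/

theorem hausdorff_le {X : Type u} {d : X → X → ℝ≥0∞} {S T : Set X} {r : ℝ≥0∞}
    (h1 : ∀ x ∈ S, ∃ y ∈ T, d x y ≤ r) (h2 : ∀ y ∈ T, ∃ x ∈ S, d x y ≤ r) :
    hausdorff d S T ≤ r :=
  max_le (iSup₂_le fun x hx => by
    obtain ⟨y, hy, h⟩ := h1 x hx
    exact (iInf₂_le y hy).trans h) (iSup₂_le fun y hy => by
    obtain ⟨x, hx, h⟩ := h2 y hy
    exact (iInf₂_le x hx).trans h)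

section Embedding

variable {A B : Type u} [CStarAlgebra A] [CStarAlgebra B]

theorem levelSet_one : levelSet (1 : B) = stateSpace B := by
  simp [levelSet]

theorem dualMap_apply (π : A →⋆ₐ[ℂ] B) (φ : WeakDual ℂ B) (a : A) : dualMap π φ a = φ (π a) :=
  rfl

theorem dualMap_mem_stateSpace (π : A →⋆ₐ[ℂ] B) {φ : WeakDual ℂ B} (hφ : φ ∈ stateSpace B) :
    dualMap π φ ∈ stateSpace A :=
  ⟨fun a => by rw [dualMap_apply, map_mul, map_star]; exact hφ.1 _,
    by rw [dualMap_apply, map_one, hφ.2]⟩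

/-- The bridge `(B, i, id, 1)` of an injective unital *-morphism `i`. -/
def Bridge.ofInjective (i : A →⋆ₐ[ℂ] B) (hi : Function.Injective i)
    (hB : (stateSpace B).Nonempty) : Bridge A B where
  space := B
  pivot := 1
  left := i
  right := StarAlgHom.id ℂ B
  levelSet_nonempty := by rwa [levelSet_one]
  left_injective := hi
  right_injective := Function.injective_id

theorem Bridge.height_ofInjective_eq_zero {i : A →⋆ₐ[ℂ] B} (hi : Function.Injective i)
    (hB : (stateSpace B).Nonempty) (LA : selfAdjoint A → ℝ≥0∞) (LB : selfAdjoint B → ℝ≥0∞)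
    (hext : ∀ φ ∈ stateSpace A, ∃ ψ ∈ stateSpace B, dualMap i ψ = φ) :
    (Bridge.ofInjective i hi hB).height LA LB = 0 := by
  have h1 : dualMap (Bridge.ofInjective i hi hB).left ''
      levelSet (Bridge.ofInjective i hi hB).pivot = stateSpace A := by
    change dualMap i '' levelSet (1 : B) = stateSpace A
    rw [levelSet_one]
    refine Set.Subset.antisymm ?_ hext
    rintro _ ⟨ψ, hψ, rfl⟩
    exact dualMap_mem_stateSpace i hψ
  have h2 : dualMap (Bridge.ofInjective i hi hB).right ''
      levelSet (Bridge.ofInjective i hi hB).pivot = stateSpace B := by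
    change dualMap (StarAlgHom.id ℂ B) '' levelSet (1 : B) = stateSpace B
    rw [levelSet_one]
    exact Set.image_id _
  rw [Bridge.height, h1, h2, ← nonpos_iff_eq_zero]
  exact max_le (hausdorff_le (fun φ hφ => ⟨φ, hφ, (mkDist_self φ).le⟩)
    fun φ hφ => ⟨φ, hφ, (mkDist_self φ).le⟩) (hausdorff_le
    (fun φ hφ => ⟨φ, hφ, (mkDist_self φ).le⟩) fun φ hφ => ⟨φ, hφ, (mkDist_self φ).le⟩)

/-- The plus sign arises because `(0, b)` is subtracted in the direct sum and the seminorm subtracts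
again. Matching elements of the two balls therefore requires a change of sign. -/
theorem Bridge.seminorm_ofInjective {i : A →⋆ₐ[ℂ] B} (hi : Function.Injective i)
    (hB : (stateSpace B).Nonempty) (a : A) (b : B) :
    (Bridge.ofInjective i hi hB).seminorm ((a, 0) - (0, b)) = ‖i a + b‖ₑ := by
  change ‖i (a - 0) * 1 - 1 * (0 - b)‖ₑ = ‖i a + b‖ₑ
  rw [sub_zero, zero_sub, mul_one, one_mul, sub_neg_eq_add]

theorem IsQuasiLeibnizQCMS.apply_neg {C D : ℝ≥0} {L : selfAdjoint A → ℝ≥0∞}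
    (hL : IsQuasiLeibnizQCMS C D L) (a : selfAdjoint A) : L (-a) = L a := by
  simpa using hL.smul (-1) a

theorem Bridge.reach_ofInjective_le {C D : ℝ≥0} {i : A →⋆ₐ[ℂ] B} (hi : Function.Injective i)
    (hB : (stateSpace B).Nonempty) {L : selfAdjoint B → ℝ≥0∞} (hL : IsQuasiLeibnizQCMS C D L)
    {r : ℝ} (h : ∀ b, L b ≤ 1 → ∃ a, L (saMap i a) ≤ 1 ∧ ‖(b : B) - i a‖ ≤ r) :
    (Bridge.ofInjective i hi hB).reach (L ∘ saMap i) L ≤ ENNReal.ofReal r := by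
  refine hausdorff_le ?_ ?_
  · rintro _ ⟨a, ha, rfl⟩
    refine ⟨_, ⟨-saMap i a, (hL.apply_neg _).trans_le ha, rfl⟩, ?_⟩
    rw [Bridge.seminorm_ofInjective]
    simp [saMap]
  · rintro _ ⟨b, hb, rfl⟩
    obtain ⟨a, ha, hab⟩ := h (-b) ((hL.apply_neg b).trans_le hb)
    refine ⟨_, ⟨a, ha, rfl⟩, ?_⟩
    rw [Bridge.seminorm_ofInjective, ← ofReal_norm]
    refine ENNReal.ofReal_le_ofReal (le_trans (le_of_eq ?_) hab)
    rw [← norm_neg, neg_add', AddSubgroup.coe_neg]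
    congr 1
    abel

end Embedding

/-! ### Inductive sequences -/

section InductiveLimit

variable {A : ℕ → Type u} [∀ n, CStarAlgebra (A n)] {α : ∀ n, A n →⋆ₐ[ℂ] A (n + 1)}
  {B : Type u} [CStarAlgebra B] {ι : ∀ n, A n →⋆ₐ[ℂ] B}

theorem iterMap_injective (hα : ∀ n, Function.Injective (α n)) (n m : ℕ) :
    Function.Injective (iterMap α n m) := by
  induction m with
  | zero => exact Function.injective_id
  | succ m ih => exact (hα (n + m)).comp ih

/-- Injective *-morphisms are isometric, so the norms whose limit is `‖ι n a‖` are constantly `‖a‖`.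
-/
theorem IsCStarInductiveLimit.injective (hι : IsCStarInductiveLimit α ι)
    (hα : ∀ n, Function.Injective (α n)) (n : ℕ) : Function.Injective (ι n) := by
  refine (AddMonoidHomClass.isometry_of_norm (ι n) fun a => ?_).injective
  refine tendsto_nhds_unique (hι.norm_eq n a) (tendsto_const_nhds.congr fun m => ?_)
  exact (NonUnitalStarAlgHom.norm_map (iterMap α n m) (iterMap_injective hα n m) a).symm

theorem IsCStarInductiveLimit.exists_apply_eq (hι : IsCStarInductiveLimit α ι) {k n : ℕ}
    (hkn : k ≤ n) (a : A k) : ∃ b : A n, ι n b = ι k a := by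
  induction n, hkn using Nat.le_induction with
  | base => exact ⟨a, rfl⟩
  | succ n _ ih =>
    obtain ⟨b, hb⟩ := ih
    exact ⟨α n b, by rw [← hb, ← hι.compat n]; rfl⟩

theorem isExpectationSystem_of_isTraceProjection [∀ n, FiniteDimensional ℂ (A n)]
    (hι : IsCStarInductiveLimit α ι) (hinj : ∀ n, Function.Injective (ι n))
    (e : A 0 ≃⋆ₐ[ℂ] ℂ) {μ : WeakDual ℂ B} (hμ : IsFaithfulTracialState μ)
    {F : ∀ n, B →L[ℂ] A n} (hF : ∀ n, IsTraceProjection (ι n) μ (F n))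
    {E : ℕ → B →L[ℂ] B} (hE : ∀ n b, E n b = ι n (F n b)) : IsExpectationSystem E := by
  have hF' : ∀ n, IsTraceProjection (ι n) μ (F n : B →ₗ[ℂ] A n) := hF
  have hFι : ∀ n x, F n (ι n x) = x := fun n => (hF' n).apply_map hμ (hinj n)
  refine ⟨fun n b => ?_, fun n => ?_, fun n b => ?_, fun n a b => ?_, fun k n hkn b => ⟨?_, ?_⟩,
    fun b => ?_, fun n => ?_, ?_⟩
  · rw [hE]
    exact (NonUnitalStarAlgHom.norm_apply_le (ι n) _).trans ((hF' n).norm_apply_le hμ (hinj n) b)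
  · rw [hE, ← map_one (ι n), hFι]
  · rw [hE, hE, ← map_star]
    exact congrArg (ι n) ((hF' n).apply_star hμ (hinj n) b)
  · have h := (hF' n).apply_mul hμ (hinj n) 1 (F n b) a
    rw [map_one, one_mul, one_mul] at h
    rw [hE, hE, hE, ← map_mul]
    exact congrArg (ι n) h
  · rw [hE, hE, hE]
    -- Tower property: a test element from `A k` is also one from `A n`, so both projections
    -- preserve its pairing with `b`.
    refine congrArg (ι k) (hμ.eq_of_forall_apply_mul_eq (hinj k) fun c => ?_)
    obtain ⟨c', hc'⟩ := hι.exists_apply_eq hkn c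
    rw [hF k, hF k, ← hc', hF n]
  · rw [hE k, hE n]
    obtain ⟨x, hx⟩ := hι.exists_apply_eq hkn (F k b)
    rw [← hx, hFι]
  · refine ⟨e (F 0 b), ?_⟩
    have h : F 0 b = e (F 0 b) • (1 : A 0) := EquivLike.injective e (by
      rw [map_smul, map_one, smul_eq_mul, mul_one])
    rw [hE]
    nth_rewrite 1 [h]
    rw [map_smul, map_one]
  · have h : (E n).range ≤ LinearMap.range (ι n : A n →ₐ[ℂ] B).toLinearMap := by
      rintro _ ⟨b, rfl⟩
      exact ⟨F n b, (hE n b).symm⟩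
    exact Submodule.finiteDimensional_of_le h
  · refine hι.dense.mono fun b hb => ?_
    obtain ⟨n, x, rfl⟩ := Set.mem_iUnion.1 hb
    exact ⟨n, by rw [hE, hFι]⟩

end InductiveLimit

theorem IsTraceProjection.exists_dualMap_eq {A B : Type u} [CStarAlgebra A] [CStarAlgebra B]
    {i : A →⋆ₐ[ℂ] B} {μ : WeakDual ℂ B} {F : B →L[ℂ] A} (hF : IsTraceProjection i μ F)
    (hμ : IsFaithfulTracialState μ) (hi : Function.Injective i) {φ : WeakDual ℂ A}
    (hφ : φ ∈ stateSpace A) : ∃ ψ ∈ stateSpace B, dualMap i ψ = φ := by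
  have hF' : IsTraceProjection i μ (F : B →ₗ[ℂ] A) := hF
  have hFi : ∀ x, F (i x) = x := hF'.apply_map hμ hi
  -- The extension is `φ ∘ F`, a state because `F` is positive and unital.
  refine ⟨StrongDual.toWeakDual ((WeakDual.toStrongDual φ).comp F), ⟨fun b => ?_, ?_⟩, ?_⟩
  · obtain ⟨c, hc⟩ := hF'.apply_star_mul_self hμ hi b
    change 0 ≤ φ (F (star b * b))
    rw [show F (star b * b) = star c * c from hc]
    exact hφ.1 c
  · change φ (F 1) = 1
    rw [← map_one i, hFi, hφ.2]
  · refine DFunLike.ext _ _ fun a => ?_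
    change φ (F (i a)) = φ a
    rw [hFi]

theorem propinquity_le_length {C D : ℝ≥0} {X Y : QuasiLeibnizQCMS.{u} C D}
    (γ : Bridge X.carrier Y.carrier) : propinquity X Y ≤ γ.length X.L Y.L :=
  iInf_le _ (Trek.single γ)

theorem mainTheorem1
    {A : ℕ → Type u} [∀ n, CStarAlgebra (A n)] [∀ n, FiniteDimensional ℂ (A n)]
    (α : ∀ n, A n →⋆ₐ[ℂ] A (n + 1)) (hα : ∀ n, Function.Injective (α n))
    (hA₀ : Nonempty (A 0 ≃⋆ₐ[ℂ] ℂ))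
    {B : Type u} [CStarAlgebra B] (ι : ∀ n, A n →⋆ₐ[ℂ] B) (hι : IsCStarInductiveLimit α ι)
    (μ : WeakDual ℂ B) (hμ : IsFaithfulTracialState μ)
    (β : ℕ → ℝ) (hβ_pos : ∀ n, 0 < β n) (hβ : Tendsto β atTop (𝓝 0)) :
    (∀ n, ∃! E : B →L[ℂ] B,
      IsConditionalExpectation (ι n).range E ∧ ∀ b, μ (E b) = μ b) ∧
    ∀ E : ℕ → B →L[ℂ] B,
      (∀ n, IsConditionalExpectation (ι n).range (E n) ∧ ∀ b, μ (E n b) = μ b) →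
      ∃ (hL : IsQuasiLeibnizQCMS 2 0 (lipNorm E β))
        (hLn : ∀ n, IsQuasiLeibnizQCMS 2 0 (lipNorm E β ∘ saMap (ι n))),
        (∀ n, propinquity (C := 2) (D := 0)
            ⟨A n, lipNorm E β ∘ saMap (ι n), hLn n⟩ ⟨B, lipNorm E β, hL⟩
              ≤ ENNReal.ofReal (β n)) ∧
        Tendsto (fun n => propinquity (C := 2) (D := 0)
            ⟨A n, lipNorm E β ∘ saMap (ι n), hLn n⟩ ⟨B, lipNorm E β, hL⟩) atTop (𝓝 0) := by
  have hinj := hι.injective hα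
  choose F hF using fun n => hμ.exists_isTraceProjection (hinj n)
  have hιcont : ∀ n, Continuous (ι n) := fun n =>
    AddMonoidHomClass.continuous_of_bound (ι n) 1 fun a => by
      rw [one_mul]; exact NonUnitalStarAlgHom.norm_apply_le (ι n) a
  refine ⟨fun n => ?_, fun E hE => ?_⟩
  · let E : B →L[ℂ] B := (⟨(ι n : A n →ₐ[ℂ] B).toLinearMap, hιcont n⟩ : A n →L[ℂ] B).comp (F n)
    refine ⟨E, (hF n).isConditionalExpectation hμ (hinj n) fun b => rfl, fun E' hE' => ?_⟩
    ext b
    exact (hF n).eq_of_isConditionalExpectation hμ (hinj n) hE'.1 hE'.2 b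
  -- By uniqueness the given expectations are the constructed ones, so all properties of `F` apply
  -- to them.
  have hEF : ∀ n b, E n b = ι n (F n b) := fun n =>
    (hF n).eq_of_isConditionalExpectation hμ (hinj n) (hE n).1 (hE n).2
  obtain ⟨e⟩ := hA₀
  have hsys := isExpectationSystem_of_isTraceProjection hι hinj e hμ hF hEF
  have hB : Nontrivial B := ⟨1, 0, fun h => by
    have := hμ.state.2
    rw [h, map_zero] at this
    exact zero_ne_one this⟩
  have hL := hsys.isQuasiLeibnizQCMS_lipNorm hβ_pos hβ
  have hLn : ∀ n, IsQuasiLeibnizQCMS 2 0 (lipNorm E β ∘ saMap (ι n)) := fun n =>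
    hL.comp_saMap (hinj n)
      (fun a => hsys.lipNorm_lt_top (m := n) (by
        rw [hEF]; exact congrArg (ι n) ((hF n).apply_map (F := (F n : B →ₗ[ℂ] A n)) hμ (hinj n) a)))
      (fun a ha => hsys.exists_norm_sub_smul_le hβ_pos ha)
  have hle : ∀ n, propinquity (C := 2) (D := 0)
      ⟨A n, lipNorm E β ∘ saMap (ι n), hLn n⟩ ⟨B, lipNorm E β, hL⟩ ≤ ENNReal.ofReal (β n) := by
    intro n
    refine (propinquity_le_length (X := ⟨A n, lipNorm E β ∘ saMap (ι n), hLn n⟩)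
      (Y := ⟨B, lipNorm E β, hL⟩)
      (Bridge.ofInjective (ι n) (hinj n) ⟨μ, hμ.state⟩)).trans (max_le ?_ ?_)
    · refine (Bridge.height_ofInjective_eq_zero (hinj n) ⟨μ, hμ.state⟩ _ _
        fun φ hφ => (hF n).exists_dualMap_eq hμ (hinj n) hφ).trans_le zero_le
    · refine Bridge.reach_ofInjective_le (hinj n) ⟨μ, hμ.state⟩ hL fun b hb => ?_
      have hs : IsSelfAdjoint (F n b) := by
        have h := (hF n).apply_star (F := (F n : B →ₗ[ℂ] A n)) hμ (hinj n) (b : B)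
        rw [selfAdjoint.star_val_eq] at h
        exact h.symm
      -- The expectation of `b` is the required approximant: it stays in the unit ball and lies
      -- within `β n` of `b`.
      refine ⟨⟨F n b, hs⟩, ?_, ?_⟩
      · exact (hsys.lipNorm_le_lipNorm hβ_pos (hEF n b).symm).trans hb
      · rw [← hEF]
        exact norm_sub_le_of_lipNorm_le_one hβ_pos hb n
  refine ⟨hL, hLn, hle, ?_⟩
  refine tendsto_of_tendsto_of_tendsto_of_le_of_le tendsto_const_nhds ?_ (fun _ => zero_le) hle
  simpa using ENNReal.tendsto_ofReal hβ
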